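/- Let $p \ge 3$ be a prime and let $\rho \in \mathbb{Z}_p$ be an element that is not a square modulo $p$. Let $\mathbb{D}_p$ be the quaternion division algebra over $\mathbb{Q}_p$, that is, the associative unital $\mathbb{Q}_p$-algebra with basis $1, u, v, uv$ and relations $u^2=\rho$, $v^2=p$, $uv+vu=0$, and let $sl_1(\mathbb{D}_p)=\{\xi\in\mathbb{D}_p : \xi+\bar\xi=0\}$ be the $\mathbb{Q}_p$-Lie algebra (under the commutator) of its elements of reduced trace $0$, where $\bar\xi=\alpha-\beta u-\gamma v-\delta uv$ for $\xi=\alpha+\beta u+\gamma v+\delta uv$. A $3$-dimensional $\mathbb{Z}_p$-Lie lattice is a Lie algebra over $\mathbb{Z}_p$ whose underlying module is free of rank $3$. A virtual endomorphism of such a lattice $L$ is a homomorphism of $\mathbb{Z}_p$-Lie algebras $\varphi : M \to L$, where $M\subseteq L$ is a Lie subalgebra of rank $3$; its index is $[L:M]$. It is simple if there is no non-zero ideal $I$ of $L$ with $I\subseteq M$ and $\varphi(I)\subseteq I$. The lattice $L$ is self-similar of index $d$ if it admits a simple virtual endomorphism of index $d$. Theorem. Let $L$ be a $3$-dimensional unsolvable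 $\mathbb{Z}_p$-Lie lattice. If $L\otimes_{\mathbb{Z}_p}\mathbb{Q}_p\simeq sl_1(\mathbb{D}_p)$ as $\mathbb{Q}_p$-Lie algebras, then $L$ is not self-similar of index $p$. -/

import Mathlib

open scoped TensorProduct

/-- The quaternion algebra `𝔻_p` over `ℚ_p` (for `p` odd): it has the `ℚ_p`-basis `1, u, v, uv` with
`u² = ρ`, `v² = p` and `uv + vu = 0`, where `ρ ∈ ℤ_p` is not a square modulo `p`. -/
abbrev QuatD (p : ℕ) [Fact p.Prime] (ρ : ℤ_[p]) : Type :=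
  QuaternionAlgebra ℚ_[p] (ρ : ℚ_[p]) 0 (p : ℚ_[p])

/-- `𝔻_p` as a Lie ring, with the commutator as bracket. -/
noncomputable instance QuatD.instLieRing (p : ℕ) [Fact p.Prime] (ρ : ℤ_[p]) : LieRing (QuatD p ρ) :=
  LieRing.ofAssociativeRing

noncomputable instance QuatD.instLieAlgebra (p : ℕ) [Fact p.Prime] (ρ : ℤ_[p]) :
    LieAlgebra ℚ_[p] (QuatD p ρ) :=
  LieAlgebra.ofAssociativeAlgebra

/-- The Lie algebra `sl₁(𝔻_p)` over `ℚ_p`: the elements `ξ` of reduced trace `ξ + ξ̄ = 0`, with the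
commutator as bracket (`star` is the quaternion conjugation). -/
def sl1 (p : ℕ) [Fact p.Prime] (ρ : ℤ_[p]) : LieSubalgebra ℚ_[p] (QuatD p ρ) where
  carrier := {ξ | ξ + star ξ = 0}
  add_mem' := by
    intro a b ha hb
    simp only [Set.mem_ofPred_eq] at *
    rw [star_add, add_add_add_comm, ha, hb, add_zero]
  zero_mem' := by simp
  smul_mem' := by
    intro c x hx
    simp only [Set.mem_ofPred_eq] at *
    ext
    · have h := congrArg QuaternionAlgebra.re hx
      simp at h ⊢
      exact Or.inr h
    all_goals simp
  lie_mem' := by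
    intro a b ha hb
    have ha' : star a = -a := (neg_eq_of_add_eq_zero_right ha).symm
    have hb' : star b = -b := (neg_eq_of_add_eq_zero_right hb).symm
    change ⁅a, b⁆ + star ⁅a, b⁆ = 0
    rw [Ring.lie_def, star_sub, star_mul, star_mul, ha', hb']
    noncomm_ring

/-- A virtual endomorphism of a `ℤ_p`-Lie lattice `L`: a Lie algebra morphism `φ : M → L`, where `M`
is a Lie subalgebra of `L` of the same dimension as `L`. -/
structure VirtualEndomorphism (p : ℕ) [Fact p.Prime] (L : Type*) [LieRing L]
    [LieAlgebra ℤ_[p] L] where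
  /-- the domain `M` -/
  domain : LieSubalgebra ℤ_[p] L
  finrank_domain : Module.finrank ℤ_[p] domain = Module.finrank ℤ_[p] L
  /-- the morphism `φ` -/
  toHom : domain →ₗ⁅ℤ_[p]⁆ L

namespace VirtualEndomorphism

variable {p : ℕ} [Fact p.Prime] {L : Type*} [LieRing L] [LieAlgebra ℤ_[p] L]

/-- The index of `φ : M → L` is the index of (the additive group of) `M` in `L`. -/
noncomputable def index (φ : VirtualEndomorphism p L) : ℕ :=
  φ.domain.toSubmodule.toAddSubgroup.index

/-- An ideal `I` of `L` is `φ`-invariant if `I ⊆ M` and `φ(I) ⊆ I`. -/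
def IsInvariant (φ : VirtualEndomorphism p L) (I : LieIdeal ℤ_[p] L) : Prop :=
  ∀ x ∈ I, ∃ h : x ∈ φ.domain, φ.toHom ⟨x, h⟩ ∈ I

/-- `φ` is simple if no non-zero ideal of `L` is `φ`-invariant. -/
def IsSimple (φ : VirtualEndomorphism p L) : Prop :=
  ∀ I : LieIdeal ℤ_[p] L, φ.IsInvariant I → I = ⊥

end VirtualEndomorphism

/-- `L` is self-similar of index `d` if it has a simple virtual endomorphism of index `d`
(meant for `1 ≤ d`). -/
def IsSelfSimilarOfIndex (p : ℕ) [Fact p.Prime] (L : Type*) [LieRing L] [LieAlgebra ℤ_[p] L]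
    (d : ℕ) : Prop :=
  ∃ φ : VirtualEndomorphism p L, φ.index = d ∧ φ.IsSimple

/-! For a pure quaternion `ξ`, the scalar `ξ²` satisfies `ad_ξ³ = 4ξ² ad_ξ` (`ad_cube`), so it can
be read off from the bracket. An injective virtual endomorphism therefore preserves it
(`sq_apply_eq`), and simplicity forces injectivity (`injective_of_isSimple`).

Since the quaternion algebra is a division algebra, the form `ξ ↦ ξ²` is anisotropic, and its size
alone decides whether `ξ` lies in the coordinate ball of radius `|p^k|` (`norm_repr_le_iff`). The
lattice itself lies in the unit ball (`norm_repr_le_one`), so its intersection with each such ball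
is a non-zero ideal. For large `k` this ideal lies in `pL`, hence in the domain when the index is
`p`. It is then invariant, so the endomorphism is not simple. -/

/-! ### Anisotropy of the form `ξ ↦ ξ²`. -/

theorem PadicInt.dvd_iff_toZMod_eq_zero {p : ℕ} [Fact p.Prime] (x : ℤ_[p]) :
    (p : ℤ_[p]) ∣ x ↔ PadicInt.toZMod x = 0 := by
  rw [← RingHom.mem_ker, PadicInt.ker_toZMod, PadicInt.maximalIdeal_eq_span_p,
    Ideal.mem_span_singleton]

theorem not_dvd_of_not_isSquare {p : ℕ} [Fact p.Prime] {ρ : ℤ_[p]}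
    (hρ : ¬ IsSquare (PadicInt.toZMod ρ)) : ¬ (p : ℤ_[p]) ∣ ρ := by
  rw [PadicInt.dvd_iff_toZMod_eq_zero]
  rintro h
  rw [h] at hρ
  exact hρ ⟨0, by simp⟩

theorem dvd_of_dvd_sq_sub {p : ℕ} [Fact p.Prime] {ρ : ℤ_[p]}
    (hρ : ¬ IsSquare (PadicInt.toZMod ρ)) {b c : ℤ_[p]} (h : (p : ℤ_[p]) ∣ b ^ 2 - ρ * c ^ 2) :
    (p : ℤ_[p]) ∣ b ∧ (p : ℤ_[p]) ∣ c := by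
  simp only [PadicInt.dvd_iff_toZMod_eq_zero, map_sub, map_mul, map_pow] at h ⊢
  have hc : PadicInt.toZMod c = 0 := by
    by_contra hc
    refine hρ ⟨PadicInt.toZMod b / PadicInt.toZMod c, ?_⟩
    field_simp
    linear_combination -h
  refine ⟨?_, hc⟩
  simpa [hc] using h

/-- The square `ξ²` of a pure quaternion `ξ = xu + yv + zuv`. -/
noncomputable def pureSq (p : ℕ) [Fact p.Prime] (ρ : ℤ_[p]) (x y z : ℚ_[p]) : ℚ_[p] :=
  ρ * x ^ 2 + p * y ^ 2 - ρ * p * z ^ 2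

/-- Modulo `p` only `ρa²` survives, so `p ∣ a`. Dividing by `p` then leaves `b² - ρc²` modulo `p`,
which is anisotropic because `ρ` is a non-residue. -/
theorem dvd_of_sq_dvd_pureSq {p : ℕ} [Fact p.Prime] {ρ : ℤ_[p]}
    (hρ : ¬ IsSquare (PadicInt.toZMod ρ)) {a b c : ℤ_[p]}
    (h : (p : ℤ_[p]) ^ 2 ∣ ρ * a ^ 2 + p * b ^ 2 - ρ * p * c ^ 2) :
    (p : ℤ_[p]) ∣ a ∧ (p : ℤ_[p]) ∣ b ∧ (p : ℤ_[p]) ∣ c := by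
  obtain ⟨d, hd⟩ := h
  have hp0 : (p : ℤ_[p]) ≠ 0 := PadicInt.prime_p.ne_zero
  have ha : (p : ℤ_[p]) ∣ a := by
    have : (p : ℤ_[p]) ∣ ρ * a ^ 2 :=
      ⟨p * d - b ^ 2 + ρ * c ^ 2, by linear_combination hd⟩
    exact PadicInt.prime_p.dvd_of_dvd_pow
      ((PadicInt.prime_p.dvd_or_dvd this).resolve_left (not_dvd_of_not_isSquare hρ))
  obtain ⟨e, rfl⟩ := ha
  refine ⟨dvd_mul_right _ _, dvd_of_dvd_sq_sub hρ ⟨d - ρ * e ^ 2, ?_⟩⟩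
  apply mul_left_cancel₀ hp0
  linear_combination hd

theorem norm_le_one_of_norm_pureSq_le_one {p : ℕ} [Fact p.Prime] {ρ : ℤ_[p]}
    (hρ : ¬ IsSquare (PadicInt.toZMod ρ)) {x y z : ℚ_[p]} (h : ‖pureSq p ρ x y z‖ ≤ 1) :
    ‖x‖ ≤ 1 ∧ ‖y‖ ≤ 1 ∧ ‖z‖ ≤ 1 := by
  have hp0 : (p : ℚ_[p]) ≠ 0 := by exact_mod_cast (Fact.out : p.Prime).ne_zero
  -- Descent: clear denominators by `p ^ n`, then remove one factor `p` at a time.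
  have key : ∀ n : ℕ, ‖(p : ℚ_[p]) ^ n * x‖ ≤ 1 → ‖(p : ℚ_[p]) ^ n * y‖ ≤ 1 →
      ‖(p : ℚ_[p]) ^ n * z‖ ≤ 1 → ‖x‖ ≤ 1 ∧ ‖y‖ ≤ 1 ∧ ‖z‖ ≤ 1 := by
    intro n
    induction n with
    | zero => intro hx hy hz; exact ⟨by simpa using hx, by simpa using hy, by simpa using hz⟩
    | succ n ih =>
      intro hx hy hz
      obtain ⟨a, ha⟩ : ∃ a : ℤ_[p], (a : ℚ_[p]) = p ^ (n + 1) * x := ⟨⟨_, hx⟩, rfl⟩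
      obtain ⟨b, hb⟩ : ∃ b : ℤ_[p], (b : ℚ_[p]) = p ^ (n + 1) * y := ⟨⟨_, hy⟩, rfl⟩
      obtain ⟨c, hc⟩ : ∃ c : ℤ_[p], (c : ℚ_[p]) = p ^ (n + 1) * z := ⟨⟨_, hz⟩, rfl⟩
      obtain ⟨d, hd⟩ : ∃ d : ℤ_[p], (d : ℚ_[p]) = pureSq p ρ x y z := ⟨⟨_, h⟩, rfl⟩
      obtain ⟨hpa, hpb, hpc⟩ := dvd_of_sq_dvd_pureSq hρ (a := a) (b := b) (c := c)
        ⟨(p : ℤ_[p]) ^ (2 * n) * d, by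
          apply Subtype.ext
          push_cast
          rw [ha, hb, hc, hd, pureSq]
          ring⟩
      have aux : ∀ (w : ℚ_[p]) (e : ℤ_[p]), (e : ℚ_[p]) = p ^ (n + 1) * w → (p : ℤ_[p]) ∣ e →
          ‖(p : ℚ_[p]) ^ n * w‖ ≤ 1 := by
        rintro w _ hw ⟨d, rfl⟩
        push_cast at hw
        have : (p : ℚ_[p]) ^ n * w = d := by
          apply mul_left_cancel₀ hp0
          linear_combination -hw
        rw [this]
        exact d.2
      exact ih (aux _ _ ha hpa) (aux _ _ hb hpb) (aux _ _ hc hpc)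
  have hex : ∀ w : ℚ_[p], ∃ N : ℕ, ∀ n ≥ N, ‖(p : ℚ_[p]) ^ n * w‖ ≤ 1 := by
    intro w
    have ht : Filter.Tendsto (fun n : ℕ => (p : ℚ_[p]) ^ n * w) Filter.atTop (nhds (0 * w)) :=
      (tendsto_pow_atTop_nhds_zero_of_norm_lt_one Padic.norm_p_lt_one).mul_const w
    rw [zero_mul] at ht
    have := ht.norm.eventually_le_const (u := 1) (by simp)
    exact Filter.eventually_atTop.1 this
  obtain ⟨n₁, h₁⟩ := hex x
  obtain ⟨n₂, h₂⟩ := hex y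
  obtain ⟨n₃, h₃⟩ := hex z
  exact key (n₁ + n₂ + n₃) (h₁ _ (by omega)) (h₂ _ (by omega)) (h₃ _ (by omega))

theorem norm_le_of_norm_pureSq_le {p : ℕ} [Fact p.Prime] {ρ : ℤ_[p]}
    (hρ : ¬ IsSquare (PadicInt.toZMod ρ)) {r : ℚ_[p]} (hr : r ≠ 0) {x y z : ℚ_[p]}
    (h : ‖pureSq p ρ x y z‖ ≤ ‖r‖ ^ 2) : ‖x‖ ≤ ‖r‖ ∧ ‖y‖ ≤ ‖r‖ ∧ ‖z‖ ≤ ‖r‖ := by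
  have hr' : 0 < ‖r‖ := norm_pos_iff.2 hr
  have e : pureSq p ρ (x / r) (y / r) (z / r) = pureSq p ρ x y z / r ^ 2 := by
    simp only [pureSq]; field_simp
  have := norm_le_one_of_norm_pureSq_le_one hρ (x := x / r) (y := y / r) (z := z / r)
    (by rw [e, norm_div, norm_pow]; exact (div_le_one (by positivity)).2 h)
  simpa only [norm_div, div_le_one hr'] using this

theorem norm_pureSq_le {p : ℕ} [Fact p.Prime] (ρ : ℤ_[p]) {r : ℝ} {x y z : ℚ_[p]}
    (hx : ‖x‖ ≤ r) (hy : ‖y‖ ≤ r) (hz : ‖z‖ ≤ r) : ‖pureSq p ρ x y z‖ ≤ r ^ 2 := by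
  have hρ1 : ‖(ρ : ℚ_[p])‖ ≤ 1 := ρ.2
  have hp1 : ‖(p : ℚ_[p])‖ ≤ 1 := Padic.norm_p_lt_one.le
  have aux : ∀ s w : ℚ_[p], ‖s‖ ≤ 1 → ‖w‖ ≤ r → ‖s * w ^ 2‖ ≤ r ^ 2 := by
    intro s w hs hw
    rw [norm_mul, norm_pow]
    calc ‖s‖ * ‖w‖ ^ 2 ≤ 1 * r ^ 2 := by gcongr
      _ = r ^ 2 := one_mul _
  rw [pureSq, sub_eq_add_neg]
  refine (IsUltrametricDist.norm_add_le_max _ _).trans (max_le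
    ((IsUltrametricDist.norm_add_le_max _ _).trans (max_le (aux _ _ hρ1 hx) (aux _ _ hp1 hy)))
    ?_)
  rw [norm_neg]
  refine aux _ _ ?_ hz
  rw [norm_mul]
  exact mul_le_one₀ hρ1 (norm_nonneg _) hp1

/-! ### The Lie algebra of pure quaternions in coordinates. -/

/-- A basis of a `ℚ_p`-Lie algebra with the structure constants of the basis `u, v, uv`
of the pure quaternions. -/
structure IsPureQuaternionBasis {p : ℕ} [Fact p.Prime] (ρ : ℤ_[p]) {V : Type*} [LieRing V]
    [LieAlgebra ℚ_[p] V] (B : Module.Basis (Fin 3) ℚ_[p] V) : Prop where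
  lie_zero_one : ⁅B 0, B 1⁆ = (2 : ℚ_[p]) • B 2
  lie_zero_two : ⁅B 0, B 2⁆ = (2 * ρ : ℚ_[p]) • B 1
  lie_one_two : ⁅B 1, B 2⁆ = (-2 * p : ℚ_[p]) • B 0

namespace IsPureQuaternionBasis

/-- The quadratic form `ξ ↦ ξ²` in the coordinates of a basis. -/
noncomputable def sq {p : ℕ} [Fact p.Prime] (ρ : ℤ_[p]) {V : Type*} [AddCommGroup V]
    [Module ℚ_[p] V] (B : Module.Basis (Fin 3) ℚ_[p] V) (x : V) : ℚ_[p] :=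
  pureSq p ρ (B.repr x 0) (B.repr x 1) (B.repr x 2)

variable {p : ℕ} [Fact p.Prime] {ρ : ℤ_[p]} {V : Type*} [LieRing V] [LieAlgebra ℚ_[p] V]
  {B : Module.Basis (Fin 3) ℚ_[p] V}

theorem lie_eq (h : IsPureQuaternionBasis ρ B) (x y : V) :
    ⁅x, y⁆ = (-2 * p * (B.repr x 1 * B.repr y 2 - B.repr x 2 * B.repr y 1)) • B 0
      + (2 * ρ * (B.repr x 0 * B.repr y 2 - B.repr x 2 * B.repr y 0)) • B 1
      + (2 * (B.repr x 0 * B.repr y 1 - B.repr x 1 * B.repr y 0)) • B 2 := by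
  have h10 : ⁅B 1, B 0⁆ = -((2 : ℚ_[p]) • B 2) := by rw [← h.lie_zero_one, lie_skew]
  have h20 : ⁅B 2, B 0⁆ = -((2 * ρ : ℚ_[p]) • B 1) := by rw [← h.lie_zero_two, lie_skew]
  have h21 : ⁅B 2, B 1⁆ = -((-2 * p : ℚ_[p]) • B 0) := by rw [← h.lie_one_two, lie_skew]
  conv_lhs => rw [← B.sum_repr x, ← B.sum_repr y]
  simp only [Fin.sum_univ_three, add_lie, lie_add, smul_lie, lie_smul, lie_self, h10, h20, h21,
    h.lie_zero_one, h.lie_zero_two, h.lie_one_two]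
  module

theorem repr_lie_zero (h : IsPureQuaternionBasis ρ B) (x y : V) : B.repr ⁅x, y⁆ 0 =
    -2 * p * (B.repr x 1 * B.repr y 2 - B.repr x 2 * B.repr y 1) := by
  rw [h.lie_eq x y]; simp

theorem repr_lie_one (h : IsPureQuaternionBasis ρ B) (x y : V) : B.repr ⁅x, y⁆ 1 =
    2 * ρ * (B.repr x 0 * B.repr y 2 - B.repr x 2 * B.repr y 0) := by
  rw [h.lie_eq x y]; simp

theorem repr_lie_two (h : IsPureQuaternionBasis ρ B) (x y : V) : B.repr ⁅x, y⁆ 2 =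
    2 * (B.repr x 0 * B.repr y 1 - B.repr x 1 * B.repr y 0) := by
  rw [h.lie_eq x y]; simp

/-- The commutator `⁅x, y⁆` anticommutes with `x`, so `ad_x` acts on it as left multiplication by
`2x`, and `(2x)² = 4x²` is a scalar. -/
theorem ad_cube (h : IsPureQuaternionBasis ρ B) (x y : V) :
    ⁅x, ⁅x, ⁅x, y⁆⁆⁆ = (4 * sq ρ B x) • ⁅x, y⁆ := by
  apply B.ext_elem
  intro i
  fin_cases i <;>
  simp only [Fin.zero_eta, Fin.mk_one, Fin.reduceFinMk, map_smul, Finsupp.smul_apply, smul_eq_mul,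
    h.repr_lie_zero, h.repr_lie_one, h.repr_lie_two, sq, pureSq] <;> ring

theorem eq_zero_of_lie_eq_zero (h : IsPureQuaternionBasis ρ B) {x : V} (hx : ∀ y : V, ⁅x, y⁆ = 0) :
    x = 0 := by
  have hp0 : (p : ℚ_[p]) ≠ 0 := by exact_mod_cast (Fact.out : p.Prime).ne_zero
  have h0 := h.repr_lie_two x (B 1)
  have h1 := h.repr_lie_two x (B 0)
  have h2 := h.repr_lie_zero x (B 1)
  simp [hx, hp0] at h0 h1 h2
  apply B.ext_elem
  intro i
  fin_cases i <;> simp [h0, h1, h2]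

theorem norm_repr_le_iff (hρ : ¬ IsSquare (PadicInt.toZMod ρ))
    (B : Module.Basis (Fin 3) ℚ_[p] V) {r : ℚ_[p]} (hr : r ≠ 0) {x : V} :
    ‖sq ρ B x‖ ≤ ‖r‖ ^ 2 ↔ ∀ i, ‖B.repr x i‖ ≤ ‖r‖ := by
  refine ⟨fun hx i => ?_, fun hx => norm_pureSq_le ρ (hx 0) (hx 1) (hx 2)⟩
  obtain ⟨h0, h1, h2⟩ := norm_le_of_norm_pureSq_le hρ hr hx
  fin_cases i <;> assumption

theorem norm_repr_lie_le (h : IsPureQuaternionBasis ρ B) {r : ℝ} {x y : V}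
    (hx : ∀ i, ‖B.repr x i‖ ≤ 1) (hy : ∀ i, ‖B.repr y i‖ ≤ r) (i : Fin 3) :
    ‖B.repr ⁅x, y⁆ i‖ ≤ r := by
  have hr : 0 ≤ r := (norm_nonneg _).trans (hy 0)
  have aux : ∀ (s : ℤ_[p]) (i j k l : Fin 3),
      ‖(s : ℚ_[p]) * (B.repr x i * B.repr y j - B.repr x k * B.repr y l)‖ ≤ r := by
    intro s i j k l
    have hm : ∀ i j, ‖B.repr x i * B.repr y j‖ ≤ r := by
      intro i j
      rw [norm_mul]
      calc _ ≤ 1 * r := mul_le_mul (hx i) (hy j) (norm_nonneg _) zero_le_one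
        _ = r := one_mul r
    rw [norm_mul, sub_eq_add_neg]
    calc _ ≤ 1 * r := mul_le_mul s.2 ((IsUltrametricDist.norm_add_le_max _ _).trans
            (max_le (hm _ _) (by rw [norm_neg]; exact hm _ _))) (norm_nonneg _) zero_le_one
      _ = r := one_mul r
  fin_cases i
  · have := aux (-2 * p) 1 2 2 1
    push_cast at this
    exact (congrArg norm (h.repr_lie_zero x y)).trans_le this
  · have := aux (2 * ρ) 0 2 2 0
    push_cast at this
    exact (congrArg norm (h.repr_lie_one x y)).trans_le this
  · have := aux 2 0 1 1 0
    exact (congrArg norm (h.repr_lie_two x y)).trans_le this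

end IsPureQuaternionBasis

theorem exists_isPureQuaternionBasis {p : ℕ} [Fact p.Prime] {ρ : ℤ_[p]} {V : Type*} [LieRing V]
    [LieAlgebra ℚ_[p] V] (e : V ≃ₗ⁅ℚ_[p]⁆ sl1 p ρ) :
    ∃ B : Module.Basis (Fin 3) ℚ_[p] V, IsPureQuaternionBasis ρ B := by
  have hre : ∀ ξ : sl1 p ρ, ξ.1.re = 0 := by
    intro ξ
    have h := congrArg QuaternionAlgebra.re ξ.2
    simp at h
    exact h
  let f : sl1 p ρ ≃ₗ[ℚ_[p]] (Fin 3 → ℚ_[p]) :=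
    { toFun := fun ξ => ![ξ.1.imI, ξ.1.imJ, ξ.1.imK]
      map_add' := by intro a b; ext i; fin_cases i <;> simp
      map_smul' := by intro a b; ext i; fin_cases i <;> simp
      invFun := fun w => ⟨⟨0, w 0, w 1, w 2⟩, by
        change _ = _
        ext <;> simp⟩
      left_inv := by intro ξ; apply Subtype.ext; ext <;> simp [hre]
      right_inv := by intro w; ext i; fin_cases i <;> simp }
  let B : Module.Basis (Fin 3) ℚ_[p] V := Module.Basis.ofEquivFun (e.toLinearEquiv.trans f)
  have hB : ∀ i, e (B i) = f.symm (Pi.single i 1) := by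
    intro i
    simp only [B, Module.Basis.coe_ofEquivFun]
    exact e.toLinearEquiv.apply_symm_apply _
  refine ⟨B, ⟨?_, ?_, ?_⟩⟩ <;>
  · apply e.injective
    change e _ = e _
    rw [LieEquiv.map_lie, map_smul, hB, hB, hB]
    apply Subtype.ext
    rw [LieSubalgebra.coe_bracket]
    change _ * _ - _ * _ = _
    ext <;> simp [f] <;> ring

theorem Padic.norm_four_eq_one {p : ℕ} [Fact p.Prime] (hp : 3 ≤ p) : ‖(4 : ℚ_[p])‖ = 1 := by
  have : ((4 : ℕ) : ℚ_[p]) = 4 := by norm_cast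
  rw [← this, Padic.norm_natCast_eq_one_iff]
  rw [Nat.Prime.coprime_iff_not_dvd Fact.out]
  intro h
  have := (Nat.Prime.dvd_of_dvd_pow (Fact.out : p.Prime) (show p ∣ 2 ^ 2 from h))
  have := Nat.le_of_dvd two_pos this
  omega

/-! ### Lattices in the pure quaternions. -/

section LatticeInQuaternions

variable {p : ℕ} [Fact p.Prime] {ρ : ℤ_[p]} {V : Type*} [LieRing V] [LieAlgebra ℚ_[p] V]
  [Module ℤ_[p] V] [IsScalarTower ℤ_[p] ℚ_[p] V] {B : Module.Basis (Fin 3) ℚ_[p] V}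
  {L : Type*} [LieRing L] [LieAlgebra ℤ_[p] L] {ι : L →ₗ[ℤ_[p]] V}

namespace IsPureQuaternionBasis

theorem exists_lie_ne_zero {V : Type*} [LieRing V] [LieAlgebra ℚ_[p] V] [Module ℤ_[p] V]
    {B : Module.Basis (Fin 3) ℚ_[p] V} {ι : L →ₗ[ℤ_[p]] V} (h : IsPureQuaternionBasis ρ B)
    (hspan : Submodule.span ℚ_[p] (Set.range ι) = ⊤) {v : V} (hv : v ≠ 0) :
    ∃ y : L, ⁅v, ι y⁆ ≠ 0 := by
  by_contra! H
  refine hv (h.eq_zero_of_lie_eq_zero fun y => ?_)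
  have hy : y ∈ Submodule.span ℚ_[p] (Set.range ι) := hspan ▸ Submodule.mem_top
  induction hy using Submodule.span_induction with
  | mem w hw => obtain ⟨y, rfl⟩ := hw; exact H y
  | zero => exact lie_zero _
  | add a b _ _ ha hb => rw [lie_add, ha, hb, add_zero]
  | smul c a _ ha => rw [lie_smul, ha, smul_zero]

/-- The scalar is an eigenvalue of `ad_x²`, which preserves the lattice. It therefore stabilises a
non-zero finitely generated module of eigenvectors, so it is integral over `ℤ_p`. -/
theorem norm_four_mul_sq_le_one [Module.Finite ℤ_[p] L] (h : IsPureQuaternionBasis ρ B)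
    (hlie : ∀ x y, ι ⁅x, y⁆ = ⁅ι x, ι y⁆)
    (hspan : Submodule.span ℚ_[p] (Set.range ι) = ⊤) (x : L) :
    ‖4 * sq ρ B (ι x)‖ ≤ 1 := by
  by_cases hx : ι x = 0
  · simp [hx, sq, pureSq]
  obtain ⟨y, hy⟩ := h.exists_lie_ne_zero hspan hx
  let N : Submodule ℤ_[p] V :=
    { carrier := {n | n ∈ LinearMap.range ι ∧ ⁅ι x, ⁅ι x, n⁆⁆ = (4 * sq ρ B (ι x)) • n}
      add_mem' := fun ha hb => ⟨add_mem ha.1 hb.1, by rw [lie_add, lie_add, ha.2, hb.2, smul_add]⟩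
      zero_mem' := ⟨zero_mem _, by simp⟩
      smul_mem' := fun c n hn => ⟨Submodule.smul_mem _ c hn.1, by
        rw [algebra_compatible_smul ℚ_[p] c n, lie_smul, lie_smul, hn.2, smul_comm]⟩ }
  have hN : N ≠ ⊥ := by
    intro hN
    have : ι ⁅x, y⁆ ∈ N := ⟨⟨_, rfl⟩, by rw [hlie, h.ad_cube]⟩
    rw [hN, Submodule.mem_bot, hlie] at this
    exact hy this
  have hfg : N.FG := by
    have hle : N ≤ LinearMap.range ι := fun n hn => hn.1
    have : IsNoetherian ℤ_[p] (LinearMap.range ι) := isNoetherian_of_isNoetherianRing_of_finite _ _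
    exact (isNoetherian_submodule.1 this) N hle
  have hint : IsIntegral ℤ_[p] (4 * sq ρ B (ι x)) := by
    refine isIntegral_of_smul_mem_submodule N hN hfg _ ?_
    rintro n ⟨⟨z, rfl⟩, hz⟩
    exact ⟨⟨⁅x, ⁅x, z⁆⁆, by rw [hlie, hlie, hz]⟩, by rw [lie_smul, lie_smul, hz]⟩
  obtain ⟨d, hd⟩ := IsIntegrallyClosed.isIntegral_iff.1 hint
  rw [← hd]
  exact d.2

theorem norm_repr_le_one [Module.Finite ℤ_[p] L] (h : IsPureQuaternionBasis ρ B) (hp : 3 ≤ p)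
    (hρ : ¬ IsSquare (PadicInt.toZMod ρ)) (hlie : ∀ x y, ι ⁅x, y⁆ = ⁅ι x, ι y⁆)
    (hspan : Submodule.span ℚ_[p] (Set.range ι) = ⊤) (x : L) (i : Fin 3) :
    ‖B.repr (ι x) i‖ ≤ 1 := by
  have h1 := h.norm_four_mul_sq_le_one hlie hspan x
  rw [norm_mul, Padic.norm_four_eq_one hp, one_mul] at h1
  have := (norm_repr_le_iff hρ B (r := 1) one_ne_zero (x := ι x)).1 (by simpa using h1) i
  simpa using this

end IsPureQuaternionBasis

/-- The change of basis from `B` to `bV` has finitely many entries, so one power of `p` makes them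
all small. -/
theorem exists_pow_forall_norm_repr_le_imp {n m : Type*} [Finite n] [Finite m]
    (B : Module.Basis m ℚ_[p] V) (bL : Module.Basis n ℤ_[p] L) (bV : Module.Basis n ℚ_[p] V)
    (hb : ∀ i, bV i = ι (bL i)) :
    ∃ k : ℕ, ∀ x : L, (∀ i, ‖B.repr (ι x) i‖ ≤ ‖(p : ℚ_[p]) ^ k‖) →
      ∃ z : L, x = (p : ℤ_[p]) • z := by
  cases nonempty_fintype n
  cases nonempty_fintype m
  have hrepr : ∀ x i, bV.repr (ι x) i = bL.repr x i := by
    intro x i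
    have : ι x = ∑ j, (bL.repr x j : ℚ_[p]) • bV j := by
      conv_lhs => rw [← bL.sum_repr x]
      rw [map_sum]
      refine Finset.sum_congr rfl fun j _ => ?_
      rw [map_smul, hb, algebra_compatible_smul ℚ_[p]]
      rfl
    rw [this, bV.repr_sum_self]
  -- Any positive bound below `1` would do: norm less than `1` means divisibility by `p`.
  have hk : ∀ᶠ k : ℕ in Filter.atTop, ∀ i j, ‖(p : ℚ_[p]) ^ k * bV.repr (B j) i‖ ≤ 2⁻¹ := by
    refine Filter.eventually_all.2 fun i => Filter.eventually_all.2 fun j => ?_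
    have ht := (tendsto_pow_atTop_nhds_zero_of_norm_lt_one
      (Padic.norm_p_lt_one (p := p))).mul_const (bV.repr (B j) i)
    rw [zero_mul] at ht
    exact ht.norm.eventually_le_const (by simp)
  obtain ⟨k, hk⟩ := hk.exists
  refine ⟨k, fun x hx => ?_⟩
  have hdvd : ∀ i, (p : ℤ_[p]) ∣ bL.repr x i := by
    intro i
    rw [← PadicInt.norm_lt_one_iff_dvd, PadicInt.norm_def, ← hrepr]
    have e : bV.repr (ι x) i = ∑ j, B.repr (ι x) j * bV.repr (B j) i := by
      conv_lhs => rw [← B.sum_repr (ι x)]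
      rw [map_sum, Finsupp.finsetSum_apply]
      simp only [map_smul, Finsupp.smul_apply, smul_eq_mul]
    rw [e]
    refine (IsUltrametricDist.norm_sum_le_of_forall_le_of_nonneg (by positivity)
      fun j _ => le_trans ?_ (hk i j)).trans_lt (by norm_num : (2⁻¹ : ℝ) < 1)
    rw [norm_mul, norm_mul]
    exact mul_le_mul_of_nonneg_right (hx j) (norm_nonneg _)
  choose c hc using hdvd
  refine ⟨∑ i, c i • bL i, ?_⟩
  rw [Finset.smul_sum]
  conv_lhs => rw [← bL.sum_repr x]
  refine Finset.sum_congr rfl fun i _ => ?_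
  rw [hc, mul_smul]

end LatticeInQuaternions

/-! ### Virtual endomorphisms of index `p`. -/

namespace VirtualEndomorphism

variable {p : ℕ} [Fact p.Prime] {L : Type*} [LieRing L] [LieAlgebra ℤ_[p] L]

theorem smul_mem_domain {φ : VirtualEndomorphism p L} (hφ : φ.index = p) (x : L) :
    (p : ℤ_[p]) • x ∈ φ.domain := by
  have h := φ.domain.toSubmodule.toAddSubgroup.nsmul_index_mem x
  change φ.index • x ∈ φ.domain at h
  rwa [hφ, ← Nat.cast_smul_eq_nsmul ℤ_[p]] at h

theorem injective_of_isSimple [Module.IsTorsionFree ℤ_[p] L] {φ : VirtualEndomorphism p L}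
    (hφ : φ.index = p) (hs : φ.IsSimple) : Function.Injective φ.toHom := by
  have hp0 : (p : ℤ_[p]) ≠ 0 := PadicInt.prime_p.ne_zero
  let θ : L →ₗ[ℤ_[p]] φ.domain :=
    (LinearMap.lsmul ℤ_[p] L p).codRestrict φ.domain.toSubmodule (smul_mem_domain hφ)
  have hθ : ∀ x : L, (θ x : L) = (p : ℤ_[p]) • x := fun _ => rfl
  let ψ : L →ₗ[ℤ_[p]] L := (φ.toHom : φ.domain →ₗ[ℤ_[p]] L).comp θ
  have hψ : ∀ x, ψ x = φ.toHom (θ x) := fun _ => rfl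
  -- The kernel of `φ` is an ideal of the domain only. Taking `p • ker ψ`, where `ψ x = φ (p x)`,
  -- gives an ideal of all of `L` inside the domain, killed by `φ`.
  let I : LieIdeal ℤ_[p] L :=
    { (LinearMap.ker ψ).map (LinearMap.lsmul ℤ_[p] L p) with
      lie_mem := by
        rintro y _ ⟨z, hz, rfl⟩
        refine ⟨⁅y, z⁆, ?_, by simp⟩
        have hz' : φ.toHom (θ z) = 0 := hz
        have : φ.toHom ⁅θ y, θ z⁆ = (p : ℤ_[p]) • ψ ⁅y, z⁆ := by
          rw [hψ, ← map_smul]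
          congr 1
          apply Subtype.ext
          rw [LieSubalgebra.coe_bracket, SetLike.val_smul, hθ, hθ, hθ, smul_lie, lie_smul]
        rw [LieHom.map_lie, hz', lie_zero] at this
        exact (smul_eq_zero.1 this.symm).resolve_left hp0 }
  have hI : I = ⊥ := by
    refine hs I ?_
    rintro _ ⟨z, hz, rfl⟩
    refine ⟨smul_mem_domain hφ z, ?_⟩
    have hz' : φ.toHom (θ z) = 0 := hz
    change φ.toHom (θ z) ∈ I
    rw [hz']
    exact zero_mem _
  rw [injective_iff_map_eq_zero]
  intro m hm
  have hmem : (p : ℤ_[p]) • (m : L) ∈ I := by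
    refine ⟨m, ?_, rfl⟩
    have e : (θ m : φ.domain) = (p : ℤ_[p]) • m := rfl
    change φ.toHom (θ m) = 0
    rw [e, map_smul, hm, smul_zero]
  rw [hI, LieSubmodule.mem_bot] at hmem
  exact Subtype.ext ((smul_eq_zero.1 hmem).resolve_left hp0)

variable {ρ : ℤ_[p]} {V : Type*} [LieRing V] [LieAlgebra ℚ_[p] V]
  [Module ℤ_[p] V] [IsScalarTower ℤ_[p] ℚ_[p] V] {B : Module.Basis (Fin 3) ℚ_[p] V}
  {ι : L →ₗ[ℤ_[p]] V}

open IsPureQuaternionBasis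

/-- Apply `φ` to the identity of `ad_cube` and compare with the same identity at `φ x`. Injectivity
keeps the bracket non-zero, so the scalars agree. -/
theorem sq_apply_eq [Module.Finite ℤ_[p] L] {φ : VirtualEndomorphism p L} (hφ : φ.index = p)
    (hinj : Function.Injective φ.toHom) (hB : IsPureQuaternionBasis ρ B)
    (hι : Function.Injective ι) (hlie : ∀ x y, ι ⁅x, y⁆ = ⁅ι x, ι y⁆)
    (hspan : Submodule.span ℚ_[p] (Set.range ι) = ⊤) (x : φ.domain) :
    sq ρ B (ι (φ.toHom x)) = sq ρ B (ι x) := by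
  have hp0 : (p : ℚ_[p]) ≠ 0 := by exact_mod_cast (Fact.out : p.Prime).ne_zero
  by_cases hx : x = 0
  · simp [hx]
  have hιx : ι (x : L) ≠ 0 := by
    rw [Ne, map_eq_zero_iff ι hι]
    exact fun h => hx (Subtype.ext h)
  obtain ⟨y, hy⟩ := hB.exists_lie_ne_zero hspan hιx
  let m : φ.domain := ⟨(p : ℤ_[p]) • y, smul_mem_domain hφ y⟩
  have hxm : ⁅x, m⁆ ≠ 0 := by
    intro h
    have h' : ι ⁅(x : L), (p : ℤ_[p]) • y⁆ = 0 := by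
      exact (congrArg (fun t : φ.domain => ι (t : L)) h).trans (map_zero ι)
    rw [hlie, map_smul, algebra_compatible_smul ℚ_[p], lie_smul, smul_eq_zero] at h'
    refine h'.elim (fun h => hp0 ?_) hy
    simpa using h
  -- Since `φ` is only `ℤ_p`-linear, the scalar must be integral to pass through it.
  obtain ⟨d, hd⟩ : ∃ d : ℤ_[p], (d : ℚ_[p]) = 4 * sq ρ B (ι x) :=
    ⟨⟨_, hB.norm_four_mul_sq_le_one hlie hspan x⟩, rfl⟩
  have hdx : ⁅x, ⁅x, ⁅x, m⁆⁆⁆ = d • ⁅x, m⁆ := by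
    apply Subtype.ext
    apply hι
    simp only [LieSubalgebra.coe_bracket, SetLike.val_smul, hlie, map_smul]
    rw [hB.ad_cube, ← hd]
    exact algebraMap_smul ℚ_[p] d ⁅ι (x : L), ι (m : L)⁆
  have h1 := congrArg (fun t => ι (φ.toHom t)) hdx
  simp only [LieHom.map_lie, map_smul, hlie, map_smul] at h1
  rw [hB.ad_cube, algebra_compatible_smul ℚ_[p] d] at h1
  have h2 : 4 * sq ρ B (ι (φ.toHom x)) = d := by
    refine smul_left_injective ℚ_[p] (m := ⁅ι (φ.toHom x), ι (φ.toHom m)⁆) ?_ h1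
    rw [← hlie, ← LieHom.map_lie, Ne, map_eq_zero_iff ι hι, map_eq_zero_iff _ hinj]
    exact hxm
  rw [hd] at h2
  exact mul_left_cancel₀ (by norm_num) h2

theorem not_isSimple_of_isPureQuaternionBasis [Module.Finite ℤ_[p] L] [Nontrivial L]
    {n : Type*} [Finite n] (hp : 3 ≤ p) (hρ : ¬ IsSquare (PadicInt.toZMod ρ))
    {φ : VirtualEndomorphism p L} (hφ : φ.index = p) (hB : IsPureQuaternionBasis ρ B)
    (hlie : ∀ x y, ι ⁅x, y⁆ = ⁅ι x, ι y⁆) (hι : Function.Injective ι)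
    (bL : Module.Basis n ℤ_[p] L) (bV : Module.Basis n ℚ_[p] V) (hb : ∀ i, bV i = ι (bL i)) :
    ¬ φ.IsSimple := by
  intro hs
  have : Module.IsTorsionFree ℤ_[p] L := bL.isTorsionFree
  have hp0 : (p : ℚ_[p]) ≠ 0 := by exact_mod_cast (Fact.out : p.Prime).ne_zero
  have hspan : Submodule.span ℚ_[p] (Set.range ι) = ⊤ := by
    rw [eq_top_iff, ← bV.span_eq]
    apply Submodule.span_mono
    rintro _ ⟨i, rfl⟩
    exact ⟨_, (hb i).symm⟩
  have hinj := injective_of_isSimple hφ hs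
  obtain ⟨k, hk⟩ := exists_pow_forall_norm_repr_le_imp (ι := ι) B bL bV hb
  have hint := hB.norm_repr_le_one hp hρ hlie hspan
  -- The ball of radius `|p^k|` in `L`; it absorbs brackets because `L` lies in the unit ball.
  let I : LieIdeal ℤ_[p] L :=
    { carrier := {x | ∀ i, ‖B.repr (ι x) i‖ ≤ ‖(p : ℚ_[p]) ^ k‖}
      add_mem' := fun {a b} ha hb i => by
        rw [map_add, map_add, Finsupp.add_apply]
        exact (IsUltrametricDist.norm_add_le_max _ _).trans (max_le (ha i) (hb i))
      zero_mem' := fun i => by simp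
      smul_mem' := fun c x hx i => by
        rw [map_smul, algebra_compatible_smul ℚ_[p] c, map_smul, Finsupp.smul_apply, norm_smul]
        exact (mul_le_mul c.2 (hx i) (norm_nonneg _) zero_le_one).trans_eq (one_mul _)
      lie_mem := fun {x y} hy i => by
        rw [hlie]
        exact hB.norm_repr_lie_le (hint x) hy i }
  have hI : I = ⊥ := by
    refine hs I fun x hx => ?_
    obtain ⟨z, rfl⟩ := hk x hx
    refine ⟨smul_mem_domain hφ z, ?_⟩
    refine (norm_repr_le_iff hρ B (pow_ne_zero k hp0)).1 ?_
    rw [sq_apply_eq hφ hinj hB hι hlie hspan]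
    exact (norm_repr_le_iff hρ B (pow_ne_zero k hp0)).2 hx
  obtain ⟨x, hx⟩ := exists_ne (0 : L)
  have hmem : (p : ℤ_[p]) ^ k • x ∈ I := by
    intro i
    rw [map_smul, algebra_compatible_smul ℚ_[p], map_smul, Finsupp.smul_apply, norm_smul, map_pow,
      map_natCast]
    exact mul_le_of_le_one_right (norm_nonneg _) (hint x i)
  rw [hI, LieSubmodule.mem_bot, smul_eq_zero] at hmem
  exact hmem.elim (pow_ne_zero k PadicInt.prime_p.ne_zero) hx

end VirtualEndomorphism

theorem mainTheorem7 (p : ℕ) [Fact p.Prime] (hp : 3 ≤ p)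
    (ρ : ℤ_[p]) (hρ : ¬ IsSquare (PadicInt.toZMod ρ))
    (L : Type*) [LieRing L] [LieAlgebra ℤ_[p] L]
    [Module.Free ℤ_[p] L] [Module.Finite ℤ_[p] L]
    (hdim : Module.finrank ℤ_[p] L = 3)
    (hunsolv : ¬ LieAlgebra.IsSolvable L)
    (hL : Nonempty ((ℚ_[p] ⊗[ℤ_[p]] L) ≃ₗ⁅ℚ_[p]⁆ sl1 p ρ)) :
    ¬ IsSelfSimilarOfIndex p L p := by
  rintro ⟨φ, hφ, hs⟩
  obtain ⟨e⟩ := hL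
  obtain ⟨B, hB⟩ := exists_isPureQuaternionBasis e
  have : Nontrivial L := Module.nontrivial_of_finrank_pos (R := ℤ_[p]) (by omega)
  let bL := Module.Free.chooseBasis ℤ_[p] L
  let bV := bL.baseChange ℚ_[p]
  refine φ.not_isSimple_of_isPureQuaternionBasis hp hρ hφ hB
    (ι := TensorProduct.mk ℤ_[p] ℚ_[p] L 1) ?_ ?_ bL bV ?_ hs
  · intro x y
    simp [LieAlgebra.ExtendScalars.bracket_tmul]
  · rw [injective_iff_map_eq_zero]
    intro x hx
    apply bL.ext_elem
    intro i
    have h : bV.repr (1 ⊗ₜ[ℤ_[p]] x) i = 0 := by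
      rw [TensorProduct.mk_apply] at hx
      simp [hx]
    rw [Module.Basis.baseChange_repr_tmul, Algebra.smul_def, mul_one] at h
    simpa using h
  · intro i
    simp [bV]
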